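/- There is an absolute constant $C>0$ with the following property. Let $g$ be a compactly supported smooth real-valued function on $[0,1]\times\mathbb{R}$ with $|g(s,z)|\le 1$ everywhere, and write $g'$ for the derivative of $g$ with respect to the second (space) variable. Let $W$ be a standard one-dimensional Brownian motion with $W(0)=0$. Then for every even positive integer $p$, $$\mathbb{E}\left(\int_0^1 g'(t,W(t))\,dt\right)^p\le C^p\,(p/2)!.$$ (The path integral exists almost surely and its $p$-th power has finite expectation.) -/

import Mathlib

open MeasureTheory ProbabilityTheory Set
open scoped NNReal ContDiff

/-!
The path integral of `g'` is, by Itô's formula, the covariation of `g (t, W t)` and `W`. On the grid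
`t i = i / N` the discrete covariation
`∑ (g (t i, W (t (i + 1))) - g (t i, W (t i))) * ΔW` is the difference of a backward and a forward
stochastic sum, neither of which involves a derivative of `g`. This is where the bound depending
only on `|g| ≤ 1` comes from.

* The forward sum `∑ g (t i, W (t i)) * ΔW` has bounded adapted coefficients. By independence of
  increments it is sub-Gaussian with variance proxy one
  (`IsPreBrownianReal.hasSubgaussianMGF_sum_mul_increment`).
* In the backward sum write `ΔW = W (t (i + 1)) / (i + 1) - η i`, where
  `η i = W (t i) - (t i / t (i + 1)) * W (t (i + 1))` is independent of `W` after time `t (i + 1)`.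
  The sum of the `g * η i` is again sub-Gaussian
  (`IsPreBrownianReal.hasSubgaussianMGF_sum_mul_backward`), because time inversion
  `u ↦ u * W (1 / u)` turns the `η i` into multiples of forward increments. The remaining drift is
  at most `∑ |W (t (i + 1))| / (i + 1)`, whose `L ^ p` norm is of order at most `√p * ∫ t ^ (-1/2) dt`
  (`IsPreBrownianReal.integral_pow_sum_drift_le`).

A variable with variance proxy `c` has `2k`-th moment at most `(8 c) ^ k * k!`, so the `2k`-th moments
of the discrete covariations are at most `17 ^ (2k) * k!`, uniformly in `N`. They converge in `L¹` to
the path integral because the quadratic variation of `W` converges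
(`IsPreBrownianReal.integral_abs_discrete_covariation_sub_le`), and the bound passes to the limit by
convexity of even powers. The rate of convergence depends on the derivatives of `g`, but not the
bound.
-/

/-! ### Moments of sub-Gaussian variables -/

theorem Real.pow_two_mul_le_factorial_mul_exp_add_exp (x : ℝ) (k : ℕ) :
    x ^ (2 * k) ≤ (2 * k).factorial * (Real.exp x + Real.exp (-x)) := by
  have h := Real.pow_div_factorial_le_exp |x| (abs_nonneg x) (2 * k)
  rw [div_le_iff₀ (by positivity), (even_two_mul k).pow_abs] at h
  have h2 : Real.exp |x| ≤ Real.exp x + Real.exp (-x) := by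
    rcases abs_cases x with ⟨h, _⟩ | ⟨h, _⟩ <;> rw [h] <;>
      linarith [Real.exp_pos x, Real.exp_pos (-x)]
  calc x ^ (2 * k) ≤ Real.exp |x| * (2 * k).factorial := h
    _ ≤ _ := by rw [mul_comm]; gcongr

namespace ProbabilityTheory.HasSubgaussianMGF

variable {Ω : Type*} {mΩ : MeasurableSpace Ω} {P : Measure Ω}

theorem integrable_pow [IsFiniteMeasure P] {X : Ω → ℝ} {c : ℝ≥0}
    (hX : HasSubgaussianMGF X c P) (k : ℕ) : Integrable (fun w => X w ^ k) P := by
  have h := (hX.memLp (k : ℝ≥0)).integrable_norm_pow' 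
  refine h.mono' (hX.aestronglyMeasurable.pow k) (ae_of_all _ fun w => ?_)
  simp

theorem mono {X : Ω → ℝ} {c d : ℝ≥0} (hX : HasSubgaussianMGF X c P) (h : c ≤ d) :
    HasSubgaussianMGF X d P where
  integrable_exp_mul := hX.integrable_exp_mul
  mgf_le t := (hX.mgf_le t).trans (by gcongr)

/-- Even moments of a sub-Gaussian variable. The exponential series bounds `(tX) ^ (2k)` by
`(2k)! (exp (tX) + exp (-tX))`, and `t ^ 2 = k / c` is the optimal choice. -/
theorem integral_pow_two_mul_le [IsProbabilityMeasure P] {X : Ω → ℝ} {c : ℝ≥0} (hc : 0 < c)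
    (hX : HasSubgaussianMGF X c P) (k : ℕ) :
    ∫ w, X w ^ (2 * k) ∂P ≤ (8 * c) ^ k * k.factorial := by
  rcases Nat.eq_zero_or_pos k with rfl | hk
  · simp
  have hc' : (0 : ℝ) < c := hc
  have hk' : (0 : ℝ) < k := by exact_mod_cast hk
  set t : ℝ := √(k / c) with ht
  have ht2 : t ^ 2 = k / c := Real.sq_sqrt (by positivity)
  have hexp : (c : ℝ) * t ^ 2 / 2 = k / 2 := by rw [ht2]; field_simp
  have hm1 : ∫ w, Real.exp (t * X w) ∂P ≤ Real.exp (k / 2) := by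
    have := hX.mgf_le t
    rwa [hexp] at this
  have hm2 : ∫ w, Real.exp (-(t * X w)) ∂P ≤ Real.exp (k / 2) := by
    have := hX.mgf_le (-t)
    rw [neg_sq, hexp] at this
    simpa [mgf] using this
  have hi1 := hX.integrable_exp_mul t
  have hi2 : Integrable (fun w => Real.exp (-(t * X w))) P := by
    simpa using hX.integrable_exp_mul (-t)
  have key : t ^ (2 * k) * ∫ w, X w ^ (2 * k) ∂P ≤
      (2 * k).factorial * (2 * Real.exp (k / 2)) := by
    rw [← integral_const_mul]
    calc ∫ w, t ^ (2 * k) * X w ^ (2 * k) ∂P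
        ≤ ∫ w, (2 * k).factorial * (Real.exp (t * X w) + Real.exp (-(t * X w))) ∂P := by
          refine integral_mono ((hX.integrable_pow _).const_mul _)
            ((hi1.add hi2).const_mul _) fun w => ?_
          have := Real.pow_two_mul_le_factorial_mul_exp_add_exp (t * X w) k
          rwa [mul_pow] at this
      _ = (2 * k).factorial *
          (∫ w, Real.exp (t * X w) ∂P + ∫ w, Real.exp (-(t * X w)) ∂P) := by
          rw [integral_const_mul, integral_add hi1 hi2]
      _ ≤ _ := by gcongr; linarith
  have he : 2 * Real.exp (k / 2) ≤ 4 ^ k := by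
    have h1 : Real.exp (k / 2) = Real.exp (1 / 2) ^ k := by
      rw [← Real.exp_nat_mul]; congr 1; ring
    have h2 : Real.exp (1 / 2) ≤ 2 := by
      have h3 : Real.exp (1 / 2) ^ 2 = Real.exp 1 := by
        rw [← Real.exp_nat_mul]; norm_num
      have := Real.exp_one_lt_d9
      nlinarith [Real.exp_pos (1 / 2)]
    calc 2 * Real.exp (k / 2) ≤ 2 ^ k * 2 ^ k := by
          rw [h1]
          gcongr
          exact le_self_pow₀ (by norm_num) hk.ne'
      _ = 4 ^ k := by rw [← mul_pow]; norm_num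
  have hf : ((2 * k).factorial : ℝ) ≤ (2 * k) ^ k * k.factorial := by
    exact_mod_cast Nat.factorial_two_mul_le k
  rw [pow_mul, ht2] at key
  have hpos : (0 : ℝ) < (k / c) ^ k := by positivity
  rw [← mul_le_mul_iff_right₀ hpos]
  calc _ ≤ _ := key
    _ ≤ ((2 * k) ^ k * k.factorial) * 4 ^ k := by gcongr
    _ = (k / c) ^ k * ((8 * c) ^ k * k.factorial) := by
      rw [← mul_assoc, ← mul_pow, mul_right_comm, ← mul_pow]
      congr 2
      field_simp
      norm_num

theorem lintegral_exp_mul_le {X : Ω → ℝ} {c : ℝ≥0} (hX : HasSubgaussianMGF X c P) (t : ℝ) :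
    ∫⁻ w, ENNReal.ofReal (Real.exp (t * X w)) ∂P ≤
      ENNReal.ofReal (Real.exp (c * t ^ 2 / 2)) := by
  rw [← ofReal_integral_eq_lintegral_ofReal (hX.integrable_exp_mul t)
    (ae_of_all _ fun w => (Real.exp_pos _).le)]
  exact ENNReal.ofReal_le_ofReal (hX.mgf_le t)

theorem of_lintegral_exp_mul_le {X : Ω → ℝ} {c : ℝ≥0} (hX : AEMeasurable X P)
    (h : ∀ t : ℝ, ∫⁻ w, ENNReal.ofReal (Real.exp (t * X w)) ∂P ≤
      ENNReal.ofReal (Real.exp (c * t ^ 2 / 2))) : HasSubgaussianMGF X c P where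
  integrable_exp_mul t := by
    refine ⟨by fun_prop, ?_⟩
    rw [hasFiniteIntegral_iff_ofReal (ae_of_all _ fun w => (Real.exp_pos _).le)]
    exact (h t).trans_lt ENNReal.ofReal_lt_top
  mgf_le t := by
    rw [mgf, integral_eq_lintegral_of_nonneg_ae (ae_of_all _ fun w => (Real.exp_pos _).le)
      (by fun_prop)]
    exact ENNReal.toReal_le_of_le_ofReal (Real.exp_pos _).le (h t)

/-- One step of the Azuma–Hoeffding argument: adding to `T` a bounded multiple of a sub-Gaussian
variable that is independent of `T` and of the multiplier adds up the variance proxies. -/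
theorem add_mul_of_indepFun [IsProbabilityMeasure P] {T Y η : Ω → ℝ} {c v b : ℝ≥0}
    (hT : HasSubgaussianMGF T c P) (hη : HasSubgaussianMGF η v P) (hY : AEMeasurable Y P)
    (hYb : ∀ w, |Y w| ≤ b) (hind : IndepFun (fun w => (T w, Y w)) η P) :
    HasSubgaussianMGF (fun w => T w + Y w * η w) (c + b ^ 2 * v) P := by
  have hTm := hT.aemeasurable
  have hηm := hη.aemeasurable
  refine of_lintegral_exp_mul_le (by fun_prop) fun t => ?_
  have hpm : AEMeasurable (fun w => (T w, Y w)) P := hTm.prodMk hY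
  have hmap := (indepFun_iff_map_prod_eq_prod_map_map hpm hηm).1 hind
  have : IsProbabilityMeasure (P.map η) := Measure.isProbabilityMeasure_map hηm
  have hη' : ∀ s : ℝ, ∫⁻ x, ENNReal.ofReal (Real.exp (s * x)) ∂(P.map η) ≤
      ENNReal.ofReal (Real.exp (v * s ^ 2 / 2)) := fun s => by
    rw [lintegral_map' (by fun_prop) hηm]
    exact hη.lintegral_exp_mul_le s
  let F : (ℝ × ℝ) × ℝ → ENNReal := fun q =>
    ENNReal.ofReal (Real.exp (t * q.1.1)) * ENNReal.ofReal (Real.exp ((t * q.1.2) * q.2))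
  have hF : Measurable F := by fun_prop
  calc ∫⁻ w, ENNReal.ofReal (Real.exp (t * (T w + Y w * η w))) ∂P
      = ∫⁻ w, F ((T w, Y w), η w) ∂P := by
        refine lintegral_congr fun w => ?_
        simp only [F]
        rw [← ENNReal.ofReal_mul (Real.exp_pos _).le, ← Real.exp_add]
        congr 2; ring
    _ = ∫⁻ q, F q ∂((P.map fun w => (T w, Y w)).prod (P.map η)) := by
        rw [← hmap, lintegral_map' hF.aemeasurable (hpm.prodMk hηm)]
    _ = ∫⁻ y, ∫⁻ x, F (y, x) ∂(P.map η) ∂(P.map fun w => (T w, Y w)) :=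
        lintegral_prod _ hF.aemeasurable
    _ ≤ ∫⁻ y, ENNReal.ofReal (Real.exp (t * y.1)) *
          ENNReal.ofReal (Real.exp (v * (t * y.2) ^ 2 / 2)) ∂(P.map fun w => (T w, Y w)) := by
        refine lintegral_mono fun y => ?_
        simp only [F]
        rw [lintegral_const_mul _ (by fun_prop)]
        gcongr
        exact hη' _
    _ = ∫⁻ w, ENNReal.ofReal (Real.exp (t * T w)) *
          ENNReal.ofReal (Real.exp (v * (t * Y w) ^ 2 / 2)) ∂P :=
        lintegral_map' (by fun_prop) hpm
    _ ≤ ∫⁻ w, ENNReal.ofReal (Real.exp (t * T w)) *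
          ENNReal.ofReal (Real.exp (v * (t * b) ^ 2 / 2)) ∂P := by
        refine lintegral_mono fun w => ?_
        have : Y w ^ 2 ≤ (b : ℝ) ^ 2 := sq_le_sq.2 (by simpa using hYb w)
        rw [mul_pow, mul_pow]
        gcongr
    _ ≤ ENNReal.ofReal (Real.exp (c * t ^ 2 / 2)) *
          ENNReal.ofReal (Real.exp (v * (t * b) ^ 2 / 2)) := by
        rw [lintegral_mul_const'' _ (by fun_prop)]
        gcongr
        exact hT.lintegral_exp_mul_le t
    _ = _ := by
        rw [← ENNReal.ofReal_mul (Real.exp_pos _).le, ← Real.exp_add]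
        congr 2
        push_cast
        ring

end ProbabilityTheory.HasSubgaussianMGF

/-! ### Forward and backward stochastic sums of Brownian motion -/

namespace ProbabilityTheory.IsPreBrownianReal

variable {Ω : Type*} {mΩ : MeasurableSpace Ω} {P : Measure Ω} {B : ℝ≥0 → Ω → ℝ}

/-- A functional of the path up to time `t k`, together with the position at that time, is
independent of the next increment. -/
theorem indepFun_sum_increment (hB : IsPreBrownianReal B P) {t : ℕ → ℝ≥0} {k : ℕ}
    (ht : ∀ i ≤ k, t i ≤ t (i + 1)) {ψ : ℕ → ℝ × ℝ → ℝ} (hψ : ∀ i, Measurable (ψ i)) :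
    IndepFun (fun w => (∑ i ∈ Finset.range k, ψ i (B (t i) w, B (t (i + 1)) w), B (t k) w))
      (fun w => B (t (k + 1)) w - B (t k) w) P := by
  have hmono : ∀ j m, j ≤ m → m ≤ k → t j ≤ t m := fun j m hjm => by
    induction hjm with
    | refl => exact fun _ => le_rfl
    | @step m _ ih => exact fun hm => (ih (by omega)).trans (ht m (by omega))
  -- the time `min s (t k)` lies in `Iic (t k)` and equals `s` for all times that occur
  let r : ℝ≥0 → Iic (t k) := fun s => ⟨min s (t k), mem_Iic.2 (min_le_right _ _)⟩
  let φ : (Iic (t k) → ℝ) → ℝ × ℝ := fun x =>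
    (∑ i ∈ Finset.range k, ψ i (x (r (t i)), x (r (t (i + 1)))), x (r (t k)))
  have hφ : Measurable φ := by fun_prop
  have h := (hB.indepFun_shift (t k)).symm.comp hφ
    (measurable_pi_apply (t (k + 1) - t k))
  convert h using 1
  · funext w
    have hr : ∀ j ≤ k, ((r (t j) : Iic (t k)) : ℝ≥0) = t j := fun j hj =>
      min_eq_left (hmono j k hj le_rfl)
    simp only [Function.comp_apply, φ]
    congr 1
    · refine Finset.sum_congr rfl fun i hi => ?_
      have hi := Finset.mem_range.1 hi
      rw [hr i hi.le, hr (i + 1) hi]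
    · rw [hr k le_rfl]
  · funext w
    simp only [Function.comp_apply]
    rw [add_tsub_cancel_of_le (ht k le_rfl)]

theorem hasSubgaussianMGF_sub (hB : IsPreBrownianReal B P) {s t : ℝ≥0} (h : s ≤ t) :
    HasSubgaussianMGF (fun w => B t w - B s w) (t - s) P := by
  have hl := hB.hasLaw_sub t s
  have hv : nndist t.1 s.1 = t - s := by
    ext
    rw [coe_nndist, Real.dist_eq, NNReal.val_eq_coe, NNReal.val_eq_coe, NNReal.coe_sub h,
      abs_of_nonneg]
    exact sub_nonneg.2 h
  rw [hv] at hl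
  refine (HasSubgaussianMGF.id_map_iff hl.aemeasurable).1 ?_
  rw [hl.map_eq]
  exact ⟨integrable_exp_mul_gaussianReal, fun u => by
    rw [mgf_gaussianReal (μ := 0) (v := t - s) (by simp)]; simp⟩

theorem hasSubgaussianMGF_eval (hB : IsPreBrownianReal B P) (t : ℝ≥0) :
    HasSubgaussianMGF (B t) t P := by
  have hl := hB.hasLaw_eval t
  refine (HasSubgaussianMGF.id_map_iff hl.aemeasurable).1 ?_
  rw [hl.map_eq]
  exact ⟨integrable_exp_mul_gaussianReal, fun u => by
    rw [mgf_gaussianReal (μ := 0) (v := t) (by simp)]; simp⟩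

/-- Discrete stochastic integrals of bounded adapted integrands against Brownian motion are
sub-Gaussian. -/
theorem hasSubgaussianMGF_sum_mul_increment [IsProbabilityMeasure P] (hB : IsPreBrownianReal B P)
    {t : ℕ → ℝ≥0} {n : ℕ} (ht : ∀ i < n, t i ≤ t (i + 1)) {φ : ℕ → ℝ → ℝ}
    (hφ : ∀ i, Measurable (φ i)) {b : ℕ → ℝ≥0} (hb : ∀ i x, |φ i x| ≤ b i) :
    HasSubgaussianMGF
      (fun w => ∑ i ∈ Finset.range n, φ i (B (t i) w) * (B (t (i + 1)) w - B (t i) w))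
      (∑ i ∈ Finset.range n, b i ^ 2 * (t (i + 1) - t i)) P := by
  induction n with
  | zero => simp
  | succ n ih =>
    simp_rw [Finset.sum_range_succ]
    have hind := hB.indepFun_sum_increment (k := n) (fun i hi => ht i (by omega))
      (ψ := fun i q => φ i q.1 * (q.2 - q.1)) (fun i => by have := hφ i; fun_prop)
    have hm : Measurable fun q : ℝ × ℝ => (q.1, φ n q.2) := by have := hφ n; fun_prop
    exact (ih fun i hi => ht i (by omega)).add_mul_of_indepFun
      (hB.hasSubgaussianMGF_sub (ht n (by omega)))
      ((hφ n).comp_aemeasurable (hB.aemeasurable _)) (fun w => hb n _)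
      (hind.comp hm measurable_id)

/-- Backward counterpart of `hasSubgaussianMGF_sum_mul_increment`: the integrand is evaluated at
the right end of each interval, and the increment is replaced by the innovation of the reversed
process, the part of `B (t i)` independent of the values at later times. By time inversion it is
the forward statement for `s ↦ s * B (1 / s)`, for which those values lie in the past. -/
theorem hasSubgaussianMGF_sum_mul_backward [IsProbabilityMeasure P] (hB : IsPreBrownianReal B P)
    {t : ℕ → ℝ≥0} {n : ℕ} (ht : ∀ i < n, t i ≤ t (i + 1)) (ht0 : ∀ i ≤ n, 0 < t i)
    {φ : ℕ → ℝ → ℝ} (hφ : ∀ i, Measurable (φ i)) (hb : ∀ i x, |φ i x| ≤ 1) :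
    HasSubgaussianMGF (fun w => ∑ i ∈ Finset.range n,
        φ i (B (t (i + 1)) w) * (B (t i) w - t i / t (i + 1) * B (t (i + 1)) w)) (t n) P := by
  have hsub : ∀ j < n, n - 1 - j + 1 = n - j ∧ n - 1 - j = n - (j + 1) := fun j hj => by omega
  have h := hB.inv.hasSubgaussianMGF_sum_mul_increment (n := n) (t := fun j => 1 / t (n - j))
    (φ := fun j x => φ (n - 1 - j) (t (n - j) * x) * t (n - 1 - j))
    (b := fun j => t (n - 1 - j)) ?_ ?_ ?_
  · refine (h.mono ?_).congr (ae_of_all _ fun w => ?_)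
    · calc ∑ j ∈ Finset.range n, t (n - 1 - j) ^ 2 * (1 / t (n - (j + 1)) - 1 / t (n - j))
          = ∑ j ∈ Finset.range n,
              (fun i => t i ^ 2 * (1 / t i - 1 / t (i + 1))) (n - 1 - j) := by
            refine Finset.sum_congr rfl fun j hj => ?_
            obtain ⟨h1, h2⟩ := hsub j (Finset.mem_range.1 hj)
            simp only
            rw [h1, h2]
        _ = ∑ i ∈ Finset.range n, t i ^ 2 * (1 / t i - 1 / t (i + 1)) :=
            Finset.sum_range_reflect (fun i => t i ^ 2 * (1 / t i - 1 / t (i + 1))) n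
        _ ≤ t n := by
            rw [← NNReal.coe_le_coe]
            push_cast
            calc ∑ i ∈ Finset.range n, (t i : ℝ) ^ 2 * ((1 / t i - 1 / t (i + 1) : ℝ≥0) : ℝ)
                ≤ ∑ i ∈ Finset.range n, ((t (i + 1) : ℝ) - t i) := by
                  refine Finset.sum_le_sum fun i hi => ?_
                  have hi := Finset.mem_range.1 hi
                  have h0 := ht0 i hi.le
                  have h1 := ht0 (i + 1) hi
                  have h2 : (t i : ℝ) ≤ t (i + 1) := ht i hi
                  rw [NNReal.coe_sub (one_div_le_one_div_of_le h0 (ht i hi))]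
                  have h0' : (0 : ℝ) < t i := h0
                  have h1' : (0 : ℝ) < t (i + 1) := h1
                  push_cast
                  have : (t i : ℝ) ^ 2 * (1 / t i - 1 / t (i + 1)) =
                      t i / t (i + 1) * (t (i + 1) - t i) := by field_simp
                  rw [this]
                  exact mul_le_of_le_one_left (by linarith) ((div_le_one h1').2 h2)
              _ = t n - t 0 := Finset.sum_range_sub (fun i => (t i : ℝ)) n
              _ ≤ t n := by simp
    · simp only
      rw [← Finset.sum_range_reflect (fun i => φ i (B (t (i + 1)) w) *
        (B (t i) w - t i / t (i + 1) * B (t (i + 1)) w)) n]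
      refine Finset.sum_congr rfl fun j hj => ?_
      have hj := Finset.mem_range.1 hj
      obtain ⟨h1, h2⟩ := hsub j hj
      have h3 : t (n - j) ≠ 0 := (ht0 _ (by omega)).ne'
      have h4 : t (n - (j + 1)) ≠ 0 := (ht0 _ (by omega)).ne'
      have h3' : (t (n - j) : ℝ) ≠ 0 := by exact_mod_cast h3
      have h4' : (t (n - (j + 1)) : ℝ) ≠ 0 := by exact_mod_cast h4
      rw [h1, h2, one_div_one_div, one_div_one_div]
      push_cast
      rw [← mul_assoc (t (n - j) : ℝ), mul_one_div_cancel h3', one_mul]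
      field_simp
  · intro j hj
    obtain ⟨h1, h2⟩ := hsub j hj
    refine one_div_le_one_div_of_le (ht0 _ (by omega)) ?_
    have := ht (n - 1 - j) (by omega)
    rwa [h1, h2] at this
  · intro j
    have := hφ (n - 1 - j)
    fun_prop
  · intro j x
    rw [abs_mul, NNReal.abs_eq]
    exact mul_le_of_le_one_left (NNReal.coe_nonneg _) (hb _ _)

end ProbabilityTheory.IsPreBrownianReal

/-! ### Moments of the discrete covariation -/

/-- The `i`-th point `i / N` of the uniform subdivision of `[0, 1]` into `N` intervals. -/
noncomputable def unitGrid (N i : ℕ) : ℝ≥0 := i / N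

theorem coe_unitGrid (N i : ℕ) : (unitGrid N i : ℝ) = i / N := by simp [unitGrid]

theorem unitGrid_le_succ (N i : ℕ) : unitGrid N i ≤ unitGrid N (i + 1) := by
  unfold unitGrid
  gcongr
  simp

theorem unitGrid_pos {N i : ℕ} (hN : 0 < N) (hi : 0 < i) : 0 < unitGrid N i := by
  unfold unitGrid
  positivity

theorem unitGrid_zero (N : ℕ) : unitGrid N 0 = 0 := by simp [unitGrid]

theorem unitGrid_self {N : ℕ} (hN : 0 < N) : unitGrid N N = 1 := by
  have : (N : ℝ≥0) ≠ 0 := by positivity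
  simp [unitGrid, this]

theorem unitGrid_succ_sub (N i : ℕ) : unitGrid N (i + 1) - unitGrid N i = 1 / N := by
  have h : unitGrid N (i + 1) = 1 / N + unitGrid N i := by
    unfold unitGrid
    push_cast
    ring
  rw [h, add_tsub_cancel_right]

theorem sum_one_div_sqrt_le (n : ℕ) :
    ∑ i ∈ Finset.range n, 1 / √((i : ℝ) + 1) ≤ 2 * √n := by
  induction n with
  | zero => simp
  | succ n ih =>
    rw [Finset.sum_range_succ]
    have h1 : 0 < √((n : ℝ) + 1) := by positivity
    have h2 : √((n : ℝ) + 1) ^ 2 = n + 1 := Real.sq_sqrt (by positivity)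
    have h3 : √(n : ℝ) ^ 2 = n := Real.sq_sqrt (by positivity)
    have h4 : 1 / √((n : ℝ) + 1) ≤ 2 * √((n : ℝ) + 1) - 2 * √n := by
      rw [div_le_iff₀ h1]
      nlinarith [sq_nonneg (√((n : ℝ) + 1) - √n)]
    push_cast
    linarith

namespace ProbabilityTheory.IsPreBrownianReal

variable {Ω : Type*} {mΩ : MeasurableSpace Ω} {P : Measure Ω} [IsProbabilityMeasure P]
  {B : ℝ≥0 → Ω → ℝ}

theorem integral_pow_eval_le (hB : IsPreBrownianReal B P) {t : ℝ≥0} (ht : 0 < t) (k : ℕ) :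
    ∫ w, B t w ^ (2 * k) ∂P ≤ (8 * t) ^ k * k.factorial :=
  (hB.hasSubgaussianMGF_eval t).integral_pow_two_mul_le ht k

/-- Moments of the drift of the time-reversed Brownian motion. The `i`-th summand has `L ^ 2k` norm
of order `1 / √((i + 1) N)`, and these add up to at most `2`; Jensen's inequality is applied with
these weights. -/
theorem integral_pow_sum_drift_le (hB : IsPreBrownianReal B P) {N : ℕ} (hN : 0 < N)
    {φ : ℕ → ℝ → ℝ} (hφ : ∀ i, Measurable (φ i)) (hb : ∀ i x, |φ i x| ≤ 1) (k : ℕ) :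
    Integrable (fun w => (∑ i ∈ Finset.range N, φ i (B (unitGrid N (i + 1)) w) *
      (B (unitGrid N (i + 1)) w / (i + 1))) ^ (2 * k)) P ∧
    ∫ w, (∑ i ∈ Finset.range N, φ i (B (unitGrid N (i + 1)) w) *
      (B (unitGrid N (i + 1)) w / (i + 1))) ^ (2 * k) ∂P ≤ 32 ^ k * k.factorial := by
  have hN' : (0 : ℝ) < N := by exact_mod_cast hN
  set t : ℕ → ℝ≥0 := fun i => unitGrid N (i + 1) with ht
  have htp : ∀ i, 0 < t i := fun i => unitGrid_pos hN (Nat.succ_pos i)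
  have htp' : ∀ i, (0 : ℝ) < t i := htp
  let v : ℕ → ℝ := fun i => √(t i) / (i + 1)
  have hv : ∀ i, 0 < v i := fun i => div_pos (Real.sqrt_pos.2 (htp' i)) (by positivity)
  set S := ∑ i ∈ Finset.range N, v i with hS
  have hS0 : 0 < S := Finset.sum_pos (fun i _ => hv i) (by simpa using hN.ne')
  have hS2 : S ≤ 2 := by
    have hv' : ∀ i, v i = (1 / √N) * (1 / √((i : ℝ) + 1)) := fun i => by
      have h2 : √((i : ℝ) + 1) * √((i : ℝ) + 1) = i + 1 := Real.mul_self_sqrt (by positivity)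
      have h3 : 0 < √((i : ℝ) + 1) := by positivity
      have h4 : 0 < √(N : ℝ) := by positivity
      simp only [v, ht, coe_unitGrid]
      push_cast
      rw [Real.sqrt_div (by positivity)]
      field_simp
      linarith
    have h4 : 0 < √(N : ℝ) := by positivity
    calc S = (1 / √N) * ∑ i ∈ Finset.range N, 1 / √((i : ℝ) + 1) := by
          rw [hS, Finset.mul_sum]; exact Finset.sum_congr rfl fun i _ => hv' i
      _ ≤ (1 / √N) * (2 * √N) := by gcongr; exact sum_one_div_sqrt_le N
      _ = 2 := by field_simp
  let y : ℕ → Ω → ℝ := fun i w => φ i (B (t i) w) * (B (t i) w / √(t i))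
  have hyle : ∀ i w, y i w ^ (2 * k) ≤ ((t i : ℝ) ^ k)⁻¹ * B (t i) w ^ (2 * k) := fun i w => by
    have h1 : φ i (B (t i) w) ^ (2 * k) ≤ 1 := by
      rw [← (even_two_mul k).pow_abs]
      exact pow_le_one₀ (abs_nonneg _) (hb i _)
    have h2 : (B (t i) w / √(t i)) ^ (2 * k) = ((t i : ℝ) ^ k)⁻¹ * B (t i) w ^ (2 * k) := by
      rw [div_pow, pow_mul √_, Real.sq_sqrt (htp' i).le, div_eq_inv_mul]
    rw [← h2]
    simp only [y]
    rw [mul_pow]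
    exact mul_le_of_le_one_left ((even_two_mul k).pow_nonneg _) h1
  have hym : ∀ i, AEMeasurable (y i) P := fun i => by
    have := hφ i
    have := hB.aemeasurable (t i)
    fun_prop
  have hBi : ∀ i, Integrable (fun w => ((t i : ℝ) ^ k)⁻¹ * B (t i) w ^ (2 * k)) P := fun i =>
    ((hB.hasSubgaussianMGF_eval _).integrable_pow _).const_mul _
  have hyi : ∀ i, Integrable (fun w => y i w ^ (2 * k)) P := fun i =>
    (hBi i).mono' ((hym i).pow_const _).aestronglyMeasurable (ae_of_all _ fun w => by
      rw [Real.norm_of_nonneg ((even_two_mul k).pow_nonneg _)]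
      exact hyle i w)
  have hyint : ∀ i, ∫ w, y i w ^ (2 * k) ∂P ≤ 8 ^ k * k.factorial := fun i =>
    calc ∫ w, y i w ^ (2 * k) ∂P ≤ ∫ w, ((t i : ℝ) ^ k)⁻¹ * B (t i) w ^ (2 * k) ∂P :=
          integral_mono (hyi i) (hBi i) (hyle i)
      _ ≤ ((t i : ℝ) ^ k)⁻¹ * ((8 * t i) ^ k * k.factorial) := by
          rw [integral_const_mul]
          have := htp' i
          gcongr
          exact hB.integral_pow_eval_le (htp i) k
      _ = 8 ^ k * k.factorial := by
          have := (pow_pos (htp' i) k).ne'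
          rw [mul_pow]
          field_simp
  have hsum : ∀ w, ∑ i ∈ Finset.range N, φ i (B (t i) w) * (B (t i) w / (i + 1)) =
      S * ∑ i ∈ Finset.range N, v i / S * y i w := fun w => by
    rw [Finset.mul_sum]
    refine Finset.sum_congr rfl fun i _ => ?_
    have h1 := Real.sqrt_pos.2 (htp' i)
    simp only [v, y]
    field_simp
  have hle : ∀ w, (∑ i ∈ Finset.range N, φ i (B (t i) w) * (B (t i) w / (i + 1))) ^ (2 * k) ≤
      2 ^ (2 * k) * ∑ i ∈ Finset.range N, v i / S * y i w ^ (2 * k) := fun w => by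
    have hj := Real.pow_arith_mean_le_arith_mean_pow_of_even (Finset.range N) (fun i => v i / S)
      (fun i => y i w) (fun i _ => (div_pos (hv i) hS0).le)
      (by rw [← Finset.sum_div, div_self hS0.ne']) (even_two_mul k)
    rw [hsum w, mul_pow]
    gcongr
    exact (even_two_mul k).pow_nonneg _
  have hri : Integrable (fun w => 2 ^ (2 * k) * ∑ i ∈ Finset.range N, v i / S * y i w ^ (2 * k)) P :=
    (integrable_finsetSum _ fun i _ => (hyi i).const_mul _).const_mul _
  have hli : Integrable (fun w =>
      (∑ i ∈ Finset.range N, φ i (B (t i) w) * (B (t i) w / (i + 1))) ^ (2 * k)) P := by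
    refine hri.mono' ?_ (ae_of_all _ fun w => ?_)
    · refine ((Finset.aemeasurable_fun_sum _ fun i _ => ?_).pow_const _).aestronglyMeasurable
      have := hφ i
      have := hB.aemeasurable (t i)
      fun_prop
    · rw [Real.norm_of_nonneg ((even_two_mul k).pow_nonneg _)]
      exact hle w
  refine ⟨hli, (integral_mono hli hri hle).trans ?_⟩
  rw [integral_const_mul, integral_finsetSum _ fun i _ => (hyi i).const_mul _]
  calc _ ≤ 2 ^ (2 * k) * ∑ i ∈ Finset.range N, v i / S * (8 ^ k * k.factorial) := by
        gcongr with i hi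
        rw [integral_const_mul]
        exact mul_le_mul_of_nonneg_left (hyint i) (div_pos (hv i) hS0).le
    _ = 32 ^ k * k.factorial := by
        rw [← Finset.sum_mul, ← Finset.sum_div, div_self hS0.ne', one_mul, ← mul_assoc, pow_mul,
          ← mul_pow]
        norm_num

/-- Moment bound for the discrete covariation of `φ (B)` and `B`. The forward sum
`∑ φ i (B (t i)) * ΔB` is sub-Gaussian; the backward sum `∑ φ i (B (t (i + 1))) * ΔB` splits into
a sub-Gaussian sum of innovations of the reversed process and its drift. -/
theorem integral_pow_discrete_covariation_le (hB : IsPreBrownianReal B P) {N : ℕ} (hN : 0 < N)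
    {φ : ℕ → ℝ → ℝ} (hφ : ∀ i, Measurable (φ i)) (hb : ∀ i x, |φ i x| ≤ 1) (k : ℕ) :
    Integrable (fun w => (∑ i ∈ Finset.range N,
      (φ i (B (unitGrid N (i + 1)) w) - φ i (B (unitGrid N i) w)) *
        (B (unitGrid N (i + 1)) w - B (unitGrid N i) w)) ^ (2 * k)) P ∧
    ∫ w, (∑ i ∈ Finset.range N,
      (φ i (B (unitGrid N (i + 1)) w) - φ i (B (unitGrid N i) w)) *
        (B (unitGrid N (i + 1)) w - B (unitGrid N i) w)) ^ (2 * k) ∂P ≤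
      17 ^ (2 * k) * k.factorial := by
  set t := unitGrid N with ht
  let F : Ω → ℝ := fun w => ∑ i ∈ Finset.range N, φ i (B (t i) w) * (B (t (i + 1)) w - B (t i) w)
  let R : Ω → ℝ := fun w => ∑ i ∈ Finset.range N,
    φ i (B (t (i + 1)) w) * (B (t i) w - t i / t (i + 1) * B (t (i + 1)) w)
  let D : Ω → ℝ := fun w => ∑ i ∈ Finset.range N,
    φ i (B (t (i + 1)) w) * (B (t (i + 1)) w / (i + 1))
  have hF : HasSubgaussianMGF F 1 P := by
    refine (hB.hasSubgaussianMGF_sum_mul_increment (fun i _ => unitGrid_le_succ N i) hφ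
      (b := fun _ => 1) (by simpa using hb)).mono ?_
    simp_rw [unitGrid_succ_sub]
    have : (N : ℝ≥0) ≠ 0 := by positivity
    simp [this]
  have hR : HasSubgaussianMGF R 1 P := by
    -- the first summand vanishes because `B 0 = 0`
    have hN1 : N - 1 + 1 = N := Nat.sub_add_cancel hN
    have h := hB.hasSubgaussianMGF_sum_mul_backward (n := N - 1) (t := fun i => t (i + 1))
      (fun i _ => unitGrid_le_succ N _) (fun i _ => unitGrid_pos hN (Nat.succ_pos i))
      (φ := fun i => φ (i + 1)) (fun i => hφ _) (fun i => hb _)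
    simp only [hN1, ht, unitGrid_self hN] at h
    refine h.congr ?_
    filter_upwards [hB.eval_zero_ae_eq_zero] with w hw
    simp only [R]
    conv_rhs => rw [← hN1, Finset.sum_range_succ']
    simp [ht, unitGrid_zero, hw]
  obtain ⟨hDi, hD⟩ := hB.integral_pow_sum_drift_le hN hφ hb k
  change Integrable (fun w => D w ^ (2 * k)) P at hDi
  change ∫ w, D w ^ (2 * k) ∂P ≤ _ at hD
  have hsplit : ∀ w, ∑ i ∈ Finset.range N, (φ i (B (t (i + 1)) w) - φ i (B (t i) w)) *
      (B (t (i + 1)) w - B (t i) w) = D w - R w - F w := fun w => by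
    simp only [D, R, F]
    rw [← Finset.sum_sub_distrib, ← Finset.sum_sub_distrib]
    refine Finset.sum_congr rfl fun i _ => ?_
    have : (t i : ℝ) / t (i + 1) = 1 - 1 / (i + 1) := by
      simp only [ht, coe_unitGrid]
      push_cast
      have : (i : ℝ) + 1 ≠ 0 := by positivity
      field_simp
      ring
    rw [this]
    ring
  simp_rw [hsplit]
  have hle : ∀ w, (D w - R w - F w) ^ (2 * k) ≤
      3 ^ (2 * k) * ((D w ^ (2 * k) + R w ^ (2 * k) + F w ^ (2 * k)) / 3) := fun w => by
    have hj := Real.pow_arith_mean_le_arith_mean_pow_of_even Finset.univ (fun _ : Fin 3 => 1 / 3)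
      ![D w, -R w, -F w] (fun _ _ => by norm_num) (by norm_num [Fin.sum_univ_three])
      (even_two_mul k)
    simp only [Fin.sum_univ_three, Matrix.cons_val, (even_two_mul k).neg_pow] at hj
    calc (D w - R w - F w) ^ (2 * k)
        = 3 ^ (2 * k) * (1 / 3 * D w + 1 / 3 * -R w + 1 / 3 * -F w) ^ (2 * k) := by
          rw [← mul_pow]; congr 1; ring
      _ ≤ 3 ^ (2 * k) * (1 / 3 * D w ^ (2 * k) + 1 / 3 * R w ^ (2 * k) + 1 / 3 * F w ^ (2 * k)) := by
          gcongr
      _ = _ := by ring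
  have hRi := hR.integrable_pow (2 * k)
  have hFi := hF.integrable_pow (2 * k)
  have hri : Integrable (fun w =>
      3 ^ (2 * k) * ((D w ^ (2 * k) + R w ^ (2 * k) + F w ^ (2 * k)) / 3)) P :=
    (((hDi.add hRi).add hFi).div_const _).const_mul _
  have hDm : AEMeasurable D P := by
    refine Finset.aemeasurable_fun_sum _ fun i _ => ?_
    have := hφ i
    have := hB.aemeasurable (t (i + 1))
    fun_prop
  have hli : Integrable (fun w => (D w - R w - F w) ^ (2 * k)) P :=
    hri.mono' (((hDm.sub hR.aemeasurable).sub hF.aemeasurable).pow_const _).aestronglyMeasurable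
      (ae_of_all _ fun w => by
        rw [Real.norm_of_nonneg ((even_two_mul k).pow_nonneg _)]
        exact hle w)
  refine ⟨hli, (integral_mono hli hri hle).trans ?_⟩
  have hR' := hR.integral_pow_two_mul_le one_pos k
  have hF' := hF.integral_pow_two_mul_le one_pos k
  have hDRi : Integrable (fun w => D w ^ (2 * k) + R w ^ (2 * k)) P := hDi.add hRi
  rw [integral_const_mul, integral_div, integral_add hDRi hFi, integral_add hDi hRi]
  have h8 : ((8 : ℝ) * (1 : ℝ≥0)) ^ k * k.factorial ≤ 32 ^ k * k.factorial := by
    gcongr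
    norm_num
  calc _ ≤ (3 : ℝ) ^ (2 * k) * (32 ^ k * k.factorial) := by
        gcongr
        linarith
    _ ≤ _ := by
        rw [← mul_assoc, pow_mul, pow_mul, ← mul_pow]
        gcongr
        norm_num

end ProbabilityTheory.IsPreBrownianReal

/-! ### Convergence of Riemann sums and of quadratic variation -/

/-- Left Riemann sums over the uniform grid converge to the integral. -/
theorem tendsto_sum_unitGrid_integral {v : ℝ → ℝ} (hv : Continuous v) :
    Filter.Tendsto (fun n : ℕ => ∑ i ∈ Finset.range (n + 1),
      v (unitGrid (n + 1) i) * (1 / ((n + 1 : ℕ) : ℝ))) Filter.atTop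
      (nhds (∫ s in (0 : ℝ)..1, v s)) := by
  have huc := isCompact_Icc.uniformContinuousOn_of_continuous (hv.continuousOn (s := Icc (0 : ℝ) 1))
  rw [Metric.uniformContinuousOn_iff] at huc
  rw [Metric.tendsto_atTop]
  intro ε hε
  obtain ⟨δ, hδ, hvδ⟩ := huc (ε / 2) (half_pos hε)
  obtain ⟨n₀, hn₀⟩ := exists_nat_one_div_lt hδ
  refine ⟨n₀, fun n hn => ?_⟩
  have hN : (0 : ℝ) < ((n + 1 : ℕ) : ℝ) := by positivity
  set N := n + 1 with hNdef
  have hNδ : 1 / (N : ℝ) < δ := by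
    refine lt_of_le_of_lt ?_ hn₀
    rw [hNdef]
    push_cast
    gcongr
  have hstep : ∀ i, (unitGrid N (i + 1) : ℝ) - unitGrid N i = 1 / N := fun i => by
    rw [coe_unitGrid, coe_unitGrid]
    push_cast
    field_simp
    ring
  have hint : ∀ a b : ℝ, IntervalIntegrable v volume a b := fun a b => hv.intervalIntegrable a b
  have hadj := intervalIntegral.sum_integral_adjacent_intervals (f := v) (μ := volume)
    (a := fun i => (unitGrid N i : ℝ)) (n := N) (fun k _ => hint _ _)
  rw [unitGrid_zero, unitGrid_self (Nat.succ_pos n)] at hadj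
  push_cast at hadj
  rw [← hadj, Real.dist_eq, ← Finset.sum_sub_distrib]
  have hterm : ∀ i ∈ Finset.range N, |v (unitGrid N i) * (1 / (N : ℝ)) -
      ∫ s in (unitGrid N i : ℝ)..unitGrid N (i + 1), v s| ≤ ε / 2 * (1 / N) := fun i hi => by
    have hi := Finset.mem_range.1 hi
    have hc : v (unitGrid N i) * (1 / (N : ℝ)) =
        ∫ _ in (unitGrid N i : ℝ)..unitGrid N (i + 1), v (unitGrid N i) := by
      rw [intervalIntegral.integral_const, hstep, smul_eq_mul, mul_comm]
    rw [hc, ← intervalIntegral.integral_sub (by simp) (hint _ _), ← Real.norm_eq_abs]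
    have hle : (unitGrid N i : ℝ) ≤ unitGrid N (i + 1) := unitGrid_le_succ N i
    refine (intervalIntegral.norm_integral_le_of_norm_le_const fun s hs => ?_).trans
      (le_of_eq (by rw [hstep, abs_of_pos (by positivity)]))
    rw [uIoc_of_le hle] at hs
    have h0 : (0 : ℝ) ≤ unitGrid N i := NNReal.coe_nonneg _
    have h1 : (unitGrid N (i + 1) : ℝ) ≤ 1 := by
      rw [coe_unitGrid, div_le_one hN]
      exact_mod_cast hi
    have := hvδ (unitGrid N i) ⟨h0, hle.trans h1⟩ s ⟨h0.trans hs.1.le, hs.2.trans h1⟩ (by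
      rw [Real.dist_eq, abs_sub_comm, abs_of_nonneg (by linarith [hs.1])]
      linarith [hs.2, hstep i])
    exact this.le
  calc _ ≤ ∑ i ∈ Finset.range N, ε / 2 * (1 / (N : ℝ)) :=
        (Finset.abs_sum_le_sum_abs _ _).trans (Finset.sum_le_sum hterm)
    _ = ε / 2 := by
        rw [Finset.sum_const, Finset.card_range, nsmul_eq_mul]
        field_simp
    _ < ε := by linarith

namespace ProbabilityTheory

variable {Ω : Type*} {mΩ : MeasurableSpace Ω} {P : Measure Ω} {B : ℝ≥0 → Ω → ℝ}

/-- Adding to `T` a bounded multiple of a centered variable that is independent of `T` and of the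
multiplier: the cross term vanishes, so that second moments add up. -/
theorem memLp_two_add_mul_of_indepFun [IsProbabilityMeasure P] {T Y η : Ω → ℝ} {b : ℝ}
    (hT : MemLp T 2 P) (hη : MemLp η 2 P) (hη0 : ∫ w, η w ∂P = 0) (hY : AEMeasurable Y P)
    (hYb : ∀ w, |Y w| ≤ b) (hind : IndepFun (fun w => (T w, Y w)) η P) :
    MemLp (fun w => T w + Y w * η w) 2 P ∧
      ∫ w, (T w + Y w * η w) ^ 2 ∂P ≤ ∫ w, T w ^ 2 ∂P + b ^ 2 * ∫ w, η w ^ 2 ∂P := by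
  have hYη : MemLp (fun w => Y w * η w) 2 P :=
    hη.of_le_mul (hY.aestronglyMeasurable.mul hη.1) (c := b) (ae_of_all _ fun w => by
      rw [norm_mul]
      exact mul_le_mul_of_nonneg_right (hYb w) (norm_nonneg _))
  refine ⟨hT.add hYη, ?_⟩
  have hcross : ∫ w, T w * (Y w * η w) ∂P = 0 := by
    have h := (hind.comp (φ := fun q : ℝ × ℝ => q.1 * q.2) (by fun_prop)
      measurable_id).integral_fun_mul_eq_mul_integral
      (hT.1.mul hY.aestronglyMeasurable) hη.1
    simp only [Function.comp_apply, id_eq, hη0, mul_zero] at h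
    simpa only [mul_assoc] using h
  have hT2 := hT.integrable_sq
  have hYη2 := hYη.integrable_sq
  have hc : Integrable (fun w => T w * (Y w * η w)) P := hT.integrable_mul hYη
  have hexp : ∀ w, (T w + Y w * η w) ^ 2 =
      T w ^ 2 + (2 * (T w * (Y w * η w)) + (Y w * η w) ^ 2) := fun w => by ring
  have hc2 : Integrable (fun w => 2 * (T w * (Y w * η w)) + (Y w * η w) ^ 2) P :=
    (hc.const_mul 2).add hYη2
  simp_rw [hexp]
  rw [integral_add hT2 hc2, integral_add (hc.const_mul 2) hYη2, integral_const_mul, hcross,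
    mul_zero, zero_add, ← integral_const_mul]
  refine add_le_add le_rfl (integral_mono hYη2 (hη.integrable_sq.const_mul _) fun w => ?_)
  have : Y w ^ 2 ≤ b ^ 2 := by
    rw [← sq_abs]
    exact pow_le_pow_left₀ (abs_nonneg _) (hYb w) 2
  simp only [mul_pow]
  gcongr

namespace IsPreBrownianReal

theorem integral_sub_sq (hB : IsPreBrownianReal B P) {s t : ℝ≥0} (h : s ≤ t) :
    ∫ w, (B t w - B s w) ^ 2 ∂P = t - s := by
  have hl := hB.hasLaw_sub t s
  have h0 : ∫ w, (B t - B s) w ∂P = 0 := by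
    rw [hl.integral_eq, integral_id_gaussianReal]
  have hv := hl.variance_eq
  rw [variance_of_integral_eq_zero hl.aemeasurable h0, variance_id_gaussianReal, coe_nndist,
    Real.dist_eq, abs_of_nonneg] at hv
  · exact hv
  · exact sub_nonneg.2 h

variable [IsProbabilityMeasure P]

theorem integral_pow_sub_le (hB : IsPreBrownianReal B P) {s t : ℝ≥0} (h : s < t) (k : ℕ) :
    ∫ w, (B t w - B s w) ^ (2 * k) ∂P ≤ (8 * (t - s)) ^ k * k.factorial := by
  have := (hB.hasSubgaussianMGF_sub h.le).integral_pow_two_mul_le (tsub_pos_of_lt h) k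
  rwa [NNReal.coe_sub h.le] at this

/-- Quadratic variation: weighted sums of `ΔB ^ 2 - Δt` with bounded adapted weights are
martingales, with second moment of order `∑ Δt ^ 2`. -/
theorem memLp_two_sum_mul_sq_increment (hB : IsPreBrownianReal B P) {t : ℕ → ℝ≥0} {n : ℕ}
    (ht : ∀ i < n, t i < t (i + 1)) {φ : ℕ → ℝ → ℝ} (hφ : ∀ i, Measurable (φ i)) {b : ℝ}
    (hb : ∀ i x, |φ i x| ≤ b) :
    MemLp (fun w => ∑ i ∈ Finset.range n, φ i (B (t i) w) *
      ((B (t (i + 1)) w - B (t i) w) ^ 2 - (t (i + 1) - t i))) 2 P ∧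
    ∫ w, (∑ i ∈ Finset.range n, φ i (B (t i) w) *
      ((B (t (i + 1)) w - B (t i) w) ^ 2 - (t (i + 1) - t i))) ^ 2 ∂P ≤
      ∑ i ∈ Finset.range n, b ^ 2 * (128 * ((t (i + 1) : ℝ) - t i) ^ 2) := by
  induction n with
  | zero => simp
  | succ n ih =>
    simp_rw [Finset.sum_range_succ]
    obtain ⟨ih1, ih2⟩ := ih fun i hi => ht i (by omega)
    have htn := ht n (by omega)
    set d : ℝ := (t (n + 1) : ℝ) - t n with hd
    have hind := hB.indepFun_sum_increment (k := n) (fun i hi => (ht i (by omega)).le)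
      (ψ := fun i q => φ i q.1 * ((q.2 - q.1) ^ 2 - (t (i + 1) - t i)))
      (fun i => by have := hφ i; fun_prop)
    have hm : Measurable fun q : ℝ × ℝ => (q.1, φ n q.2) := by have := hφ n; fun_prop
    have hm2 : Measurable fun x : ℝ => x ^ 2 - d := by fun_prop
    have hS := hB.hasSubgaussianMGF_sub htn.le
    have hi2 := hS.integrable_pow 2
    have hi4 := hS.integrable_pow 4
    have hsq : ∀ w, ((B (t (n + 1)) w - B (t n) w) ^ 2 - d) ^ 2 =
        (B (t (n + 1)) w - B (t n) w) ^ 4 -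
          (2 * d * (B (t (n + 1)) w - B (t n) w) ^ 2 - d ^ 2) := fun w => by ring
    have hr : Integrable (fun w => 2 * d * (B (t (n + 1)) w - B (t n) w) ^ 2 - d ^ 2) P :=
      (hi2.const_mul _).sub (integrable_const _)
    have hη : MemLp (fun w => (B (t (n + 1)) w - B (t n) w) ^ 2 - d) 2 P := by
      refine (memLp_two_iff_integrable_sq (f := fun w => (B (t (n + 1)) w - B (t n) w) ^ 2 - d)
        (hi2.1.sub aestronglyMeasurable_const)).2 ?_
      simp_rw [hsq]
      exact hi4.sub hr
    have hη0 : ∫ w, ((B (t (n + 1)) w - B (t n) w) ^ 2 - d) ∂P = 0 := by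
      rw [integral_sub hi2 (integrable_const _), hB.integral_sub_sq htn.le]
      simp [hd]
    have hη2 : ∫ w, ((B (t (n + 1)) w - B (t n) w) ^ 2 - d) ^ 2 ∂P ≤ 128 * d ^ 2 := by
      simp_rw [hsq]
      rw [integral_sub hi4 hr, integral_sub (hi2.const_mul _) (integrable_const _),
        integral_const_mul, hB.integral_sub_sq htn.le]
      have := hB.integral_pow_sub_le htn 2
      norm_num [Nat.factorial] at this ⊢
      rw [← hd] at this ⊢
      nlinarith [sq_nonneg d]
    obtain ⟨h1, h2⟩ := memLp_two_add_mul_of_indepFun ih1 hη hη0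
      ((hφ n).comp_aemeasurable (hB.aemeasurable _)) (fun w => hb n _) (hind.comp hm hm2)
    refine ⟨h1, h2.trans ?_⟩
    gcongr

/-- The discrete covariation of `G (t, B t)` and `B` is close in `L¹` to the Riemann sum of the
space derivative `H` of `G`: Taylor's formula reduces this to the convergence of quadratic
variation, up to third moments of the increments. -/
theorem integral_abs_discrete_covariation_sub_le (hB : IsPreBrownianReal B P) {G H : ℝ → ℝ → ℝ}
    (hG : ∀ s, Measurable (G s)) (hH : ∀ s, Measurable (H s)) {M K : ℝ} (hK : 0 ≤ K)
    (hM : ∀ s x, |H s x| ≤ M) (hGH : ∀ s x y, |G s y - G s x - H s x * (y - x)| ≤ K * (y - x) ^ 2)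
    {N : ℕ} (hN : 0 < N) :
    Integrable (fun w => ∑ i ∈ Finset.range N,
        (G (unitGrid N i) (B (unitGrid N (i + 1)) w) - G (unitGrid N i) (B (unitGrid N i) w)) *
          (B (unitGrid N (i + 1)) w - B (unitGrid N i) w) -
        ∑ i ∈ Finset.range N, H (unitGrid N i) (B (unitGrid N i) w) * (1 / (N : ℝ))) P ∧
    ∫ w, |∑ i ∈ Finset.range N,
        (G (unitGrid N i) (B (unitGrid N (i + 1)) w) - G (unitGrid N i) (B (unitGrid N i) w)) *
          (B (unitGrid N (i + 1)) w - B (unitGrid N i) w) -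
        ∑ i ∈ Finset.range N, H (unitGrid N i) (B (unitGrid N i) w) * (1 / (N : ℝ))| ∂P ≤
      (1 / 2 + 64 * M ^ 2 + 68 * K) / √N := by
  have hN' : (0 : ℝ) < N := by exact_mod_cast hN
  set t := unitGrid N with ht
  set s := √(N : ℝ) with hs
  have hs0 : 0 < s := Real.sqrt_pos.2 hN'
  have hs2 : s ^ 2 = N := Real.sq_sqrt hN'.le
  have hd : ∀ i, (t (i + 1) : ℝ) - t i = 1 / N := fun i => by
    simp only [ht, coe_unitGrid]
    push_cast
    field_simp
    ring
  have hlt : ∀ i, t i < t (i + 1) := fun i => by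
    rw [← NNReal.coe_lt_coe, ← sub_pos, hd]
    positivity
  let x : ℕ → Ω → ℝ := fun i w => B (t (i + 1)) w - B (t i) w
  let a : ℕ → Ω → ℝ := fun i w => H (t i) (B (t i) w)
  let D : Ω → ℝ := fun w => ∑ i ∈ Finset.range N,
    (G (t i) (B (t (i + 1)) w) - G (t i) (B (t i) w)) * x i w -
      ∑ i ∈ Finset.range N, a i w * (1 / (N : ℝ))
  let Q : Ω → ℝ := fun w => ∑ i ∈ Finset.range N, a i w * (x i w ^ 2 - 1 / N)
  obtain ⟨hQ, hQ2⟩ : MemLp Q 2 P ∧ ∫ w, Q w ^ 2 ∂P ≤ 128 * M ^ 2 / N := by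
    have h := hB.memLp_two_sum_mul_sq_increment (n := N) (fun i _ => hlt i)
      (φ := fun i => H (t i)) (fun i => hH _) (fun i x => hM _ x)
    simp_rw [hd] at h
    refine ⟨h.1, h.2.trans (le_of_eq ?_)⟩
    rw [Finset.sum_const, Finset.card_range, nsmul_eq_mul]
    field_simp
  have hxi : ∀ i k, Integrable (fun w => x i w ^ k) P := fun i k =>
    (hB.hasSubgaussianMGF_sub (hlt i).le).integrable_pow k
  -- `|Q|` and `|x| ^ 3` are bounded by even powers through Young's inequality, balanced by `s = √N`
  let Z : Ω → ℝ := fun w => (1 / s + s * Q w ^ 2) / 2 +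
    K * ∑ i ∈ Finset.range N, (x i w ^ 2 / s + s * x i w ^ 4) / 2
  have hDZ : ∀ w, |D w| ≤ Z w := fun w => by
    have hD : D w = Q w + ∑ i ∈ Finset.range N,
        (G (t i) (B (t (i + 1)) w) - G (t i) (B (t i) w) - a i w * x i w) * x i w := by
      simp only [D, Q]
      rw [← Finset.sum_sub_distrib, ← Finset.sum_add_distrib]
      exact Finset.sum_congr rfl fun i _ => by ring
    have hQ' : |Q w| ≤ (1 / s + s * Q w ^ 2) / 2 := by
      have h := sq_nonneg (s * |Q w| - 1)
      have : (1 / s + s * Q w ^ 2) / 2 - |Q w| = (s * |Q w| - 1) ^ 2 / (2 * s) := by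
        rw [← sq_abs (Q w)]
        field_simp
        ring
      have : 0 ≤ (s * |Q w| - 1) ^ 2 / (2 * s) := by positivity
      linarith
    have hT : ∀ i, |(G (t i) (B (t (i + 1)) w) - G (t i) (B (t i) w) - a i w * x i w) * x i w| ≤
        K * ((x i w ^ 2 / s + s * x i w ^ 4) / 2) := fun i => by
      rw [abs_mul]
      have h1 : |x i w| ^ 3 ≤ (x i w ^ 2 / s + s * x i w ^ 4) / 2 := by
        have : (x i w ^ 2 / s + s * x i w ^ 4) / 2 - |x i w| ^ 3 =
            |x i w| ^ 2 * (s * |x i w| - 1) ^ 2 / (2 * s) := by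
          have h4 : x i w ^ 4 = |x i w| ^ 4 := by rw [Even.pow_abs ⟨2, rfl⟩]
          rw [← sq_abs (x i w), h4]
          field_simp
          ring
        have : 0 ≤ |x i w| ^ 2 * (s * |x i w| - 1) ^ 2 / (2 * s) := by positivity
        linarith
      calc _ ≤ K * x i w ^ 2 * |x i w| := by
            gcongr
            exact hGH _ _ _
        _ = K * |x i w| ^ 3 := by rw [← sq_abs (x i w)]; ring
        _ ≤ _ := by gcongr
    rw [hD]
    refine (abs_add_le _ _).trans (add_le_add hQ' ?_)
    rw [Finset.mul_sum]
    exact (Finset.abs_sum_le_sum_abs _ _).trans (Finset.sum_le_sum fun i _ => hT i)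
  have hZ1 : Integrable (fun w => (1 / s + s * Q w ^ 2) / 2) P :=
    ((integrable_const _).add (hQ.integrable_sq.const_mul _)).div_const _
  have hZi : ∀ i, Integrable (fun w => (x i w ^ 2 / s + s * x i w ^ 4) / 2) P := fun i =>
    (((hxi i 2).div_const _).add ((hxi i 4).const_mul _)).div_const _
  have hZ2 : Integrable (fun w =>
      K * ∑ i ∈ Finset.range N, (x i w ^ 2 / s + s * x i w ^ 4) / 2) P :=
    (integrable_finsetSum _ fun i _ => hZi i).const_mul _
  have hDm : AEMeasurable D P := by
    refine (Finset.aemeasurable_fun_sum _ fun i _ => ?_).sub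
      (Finset.aemeasurable_fun_sum _ fun i _ => ?_)
    all_goals
      have := hG (t i)
      have := hH (t i)
      have := hB.aemeasurable (t i)
      have := hB.aemeasurable (t (i + 1))
      fun_prop
  have hDi : Integrable D P := (hZ1.add hZ2).mono' hDm.aestronglyMeasurable (ae_of_all _ hDZ)
  refine ⟨hDi, (integral_mono hDi.abs (hZ1.add hZ2) hDZ).trans ?_⟩
  have e1 : ∫ w, (1 / s + s * Q w ^ 2) / 2 ∂P ≤ (1 / 2 + 64 * M ^ 2) / s := by
    rw [integral_div, integral_add (integrable_const _) (hQ.integrable_sq.const_mul _),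
      integral_const_mul]
    simp only [integral_const, probReal_univ, one_smul]
    calc _ ≤ (1 / s + s * (128 * M ^ 2 / N)) / 2 := by gcongr
      _ = _ := by
        rw [← hs2]
        field_simp
        ring
  have e2 : ∀ i, ∫ w, (x i w ^ 2 / s + s * x i w ^ 4) / 2 ∂P ≤ 68 / s / N := fun i => by
    rw [integral_div, integral_add ((hxi i 2).div_const _) ((hxi i 4).const_mul _),
      integral_div, integral_const_mul]
    have h2 := hB.integral_pow_sub_le (hlt i) 1
    have h4 := hB.integral_pow_sub_le (hlt i) 2
    rw [hd] at h2 h4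
    norm_num [Nat.factorial] at h2 h4
    calc _ ≤ (8 * (N : ℝ)⁻¹ / s + s * ((8 * (N : ℝ)⁻¹) ^ 2 * 2)) / 2 := by gcongr
      _ = _ := by
        rw [← hs2]
        field_simp
        ring
  calc ∫ w, Z w ∂P = ∫ w, (1 / s + s * Q w ^ 2) / 2 ∂P +
        K * ∑ i ∈ Finset.range N, ∫ w, (x i w ^ 2 / s + s * x i w ^ 4) / 2 ∂P := by
        simp only [Z]
        rw [integral_add hZ1 hZ2, integral_const_mul, integral_finsetSum _ fun i _ => hZi i]
    _ ≤ (1 / 2 + 64 * M ^ 2) / s + K * ∑ i ∈ Finset.range N, 68 / s / (N : ℝ) := by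
        gcongr
        exact e2 _
    _ = _ := by
        rw [Finset.sum_const, Finset.card_range, nsmul_eq_mul]
        field_simp

end IsPreBrownianReal

end ProbabilityTheory

/-! ### The limit of the moment bound -/

/-- The tangent line inequality for even powers. -/
theorem pow_two_mul_le_add_of_pos {k : ℕ} (hk : 0 < k) (a b : ℝ) :
    b ^ (2 * k) ≤ a ^ (2 * k) + (2 * k : ℕ) * (b ^ (2 * k - 1) * (b - a)) := by
  rcases eq_or_ne b 0 with rfl | hb
  · have h1 : 2 * k ≠ 0 := by omega
    have h2 : 2 * k - 1 ≠ 0 := by omega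
    simpa [h1, h2] using (even_two_mul k).pow_nonneg a
  have hbern : ∀ x : ℝ, 1 + (2 * k : ℕ) * x ≤ (1 + x) ^ (2 * k) := fun x => by
    rcases le_or_gt (-2) x with hx | hx
    · exact one_add_mul_le_pow hx _
    · have h1 : (1 : ℝ) ≤ (2 * k : ℕ) := by exact_mod_cast (by omega : 1 ≤ 2 * k)
      have h2 := (even_two_mul k).pow_nonneg (1 + x)
      nlinarith
  have hpow : b ^ (2 * k) = b ^ (2 * k - 1) * b := by
    rw [← pow_succ, Nat.sub_add_cancel (by omega)]
  have h := mul_le_mul_of_nonneg_left (hbern ((a - b) / b)) ((even_two_mul k).pow_nonneg b)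
  rw [← mul_pow] at h
  have h1 : b * (1 + (a - b) / b) = a := by field_simp; ring
  have h2 : b ^ (2 * k) * (1 + (2 * k : ℕ) * ((a - b) / b)) =
      b ^ (2 * k) + (2 * k : ℕ) * (b ^ (2 * k - 1) * (a - b)) := by
    rw [hpow]
    field_simp
  rw [h1, h2] at h
  linarith

namespace ProbabilityTheory.IsBrownianReal

variable {Ω : Type*} {mΩ : MeasurableSpace Ω} {P : Measure Ω} {B : ℝ≥0 → Ω → ℝ}

theorem ae_continuous_comp (hB : IsBrownianReal B P) {H : ℝ → ℝ → ℝ}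
    (hH : Continuous (Function.uncurry H)) :
    ∀ᵐ w ∂P, Continuous fun s : ℝ => H s (B s.toNNReal w) := by
  filter_upwards [hB.cont] with w hw
  exact hH.comp (continuous_id.prodMk (hw.comp continuous_real_toNNReal))

variable [IsProbabilityMeasure P]

/-- The path integral of `H (s, B s)` is the `L¹` limit of its Riemann sums. -/
theorem tendsto_integral_abs_sum_sub (hB : IsBrownianReal B P) {H : ℝ → ℝ → ℝ}
    (hH : Continuous (Function.uncurry H)) {M : ℝ} (hM : ∀ s x, |H s x| ≤ M) :
    Integrable (fun w => ∫ s in (0 : ℝ)..1, H s (B s.toNNReal w)) P ∧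
    (∀ N, Integrable (fun w => ∑ i ∈ Finset.range N,
      H (unitGrid N i) (B (unitGrid N i) w) * (1 / (N : ℝ))) P) ∧
    Filter.Tendsto (fun n : ℕ => ∫ w, |∑ i ∈ Finset.range (n + 1),
        H (unitGrid (n + 1) i) (B (unitGrid (n + 1) i) w) * (1 / ((n + 1 : ℕ) : ℝ)) -
        ∫ s in (0 : ℝ)..1, H s (B s.toNNReal w)| ∂P) Filter.atTop (nhds 0) := by
  let I : Ω → ℝ := fun w => ∫ s in (0 : ℝ)..1, H s (B s.toNNReal w)
  let R : ℕ → Ω → ℝ := fun N w => ∑ i ∈ Finset.range N,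
      H (unitGrid N i) (B (unitGrid N i) w) * (1 / (N : ℝ))
  have hM0 : 0 ≤ M := (abs_nonneg _).trans (hM 0 0)
  have hIle : ∀ w, |I w| ≤ M := fun w => by
    have h := intervalIntegral.norm_integral_le_of_norm_le_const (a := (0 : ℝ)) (b := 1)
      (f := fun s : ℝ => H s (B s.toNNReal w)) (C := M) fun s _ => hM s _
    simpa using h
  have hRle : ∀ N w, |R N w| ≤ M := fun N w => by
    rcases Nat.eq_zero_or_pos N with rfl | hN
    · simpa [R] using hM0
    have hN' : (0 : ℝ) < N := by exact_mod_cast hN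
    calc |R N w| ≤ ∑ i ∈ Finset.range N, M * (1 / (N : ℝ)) := by
          refine (Finset.abs_sum_le_sum_abs _ _).trans (Finset.sum_le_sum fun i _ => ?_)
          rw [abs_mul, abs_of_pos (by positivity : (0 : ℝ) < 1 / N)]
          gcongr
          exact hM _ _
      _ = M := by
          rw [Finset.sum_const, Finset.card_range, nsmul_eq_mul]
          field_simp
  have hRm : ∀ N, AEMeasurable (R N) P := fun N =>
    Finset.aemeasurable_fun_sum _ fun i _ => by
      have h1 : Measurable (H (unitGrid N i)) := (hH.uncurry_left _).measurable
      have h2 := hB.aemeasurable (unitGrid N i)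
      fun_prop
  have hlim : ∀ᵐ w ∂P, Filter.Tendsto (fun n => R (n + 1) w) Filter.atTop (nhds (I w)) := by
    filter_upwards [hB.ae_continuous_comp hH] with w hw
    have := tendsto_sum_unitGrid_integral hw
    simpa only [Real.toNNReal_coe] using this
  have hIm : AEMeasurable I P :=
    aemeasurable_of_tendsto_metrizable_ae' (fun n => hRm (n + 1)) hlim
  refine ⟨(integrable_const M).mono' hIm.aestronglyMeasurable (ae_of_all _ hIle),
    fun N => (integrable_const M).mono' (hRm N).aestronglyMeasurable (ae_of_all _ (hRle N)), ?_⟩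
  have h := tendsto_integral_of_dominated_convergence (μ := P)
    (F := fun n w => |R (n + 1) w - I w|) (f := fun _ => 0) (fun _ => 2 * M)
    (fun n => ((hRm (n + 1)).sub hIm).abs.aestronglyMeasurable) (integrable_const _)
    (fun n => ae_of_all _ fun w => by
      rw [Real.norm_eq_abs, abs_abs]
      linarith [abs_sub (R (n + 1) w) (I w), hIle w, hRle (n + 1) w])
    (by
      filter_upwards [hlim] with w hw
      have := (hw.sub_const (I w)).abs
      simpa using this)
  simpa only [integral_zero] using h

/-- The moment bound for bounded continuous `H` that is the space derivative of a function `G`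
bounded by one. The bound for the discrete covariations passes to the path integral by `L¹`
convergence, since the path integral is bounded and even powers lie above their tangents. -/
theorem integral_pow_path_integral_le (hB : IsBrownianReal B P) {G H : ℝ → ℝ → ℝ}
    (hG : ∀ s, Measurable (G s)) (hG1 : ∀ s x, |G s x| ≤ 1) (hH : Continuous (Function.uncurry H))
    {M K : ℝ} (hK : 0 ≤ K) (hM : ∀ s x, |H s x| ≤ M)
    (hGH : ∀ s x y, |G s y - G s x - H s x * (y - x)| ≤ K * (y - x) ^ 2) {k : ℕ} (hk : 0 < k) :
    Integrable (fun w => (∫ s in (0 : ℝ)..1, H s (B s.toNNReal w)) ^ (2 * k)) P ∧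
    ∫ w, (∫ s in (0 : ℝ)..1, H s (B s.toNNReal w)) ^ (2 * k) ∂P ≤
      17 ^ (2 * k) * k.factorial := by
  let I : Ω → ℝ := fun w => ∫ s in (0 : ℝ)..1, H s (B s.toNNReal w)
  let R : ℕ → Ω → ℝ := fun N w => ∑ i ∈ Finset.range N,
      H (unitGrid N i) (B (unitGrid N i) w) * (1 / (N : ℝ))
  let X : ℕ → Ω → ℝ := fun N w => ∑ i ∈ Finset.range N,
      (G (unitGrid N i) (B (unitGrid N (i + 1)) w) - G (unitGrid N i) (B (unitGrid N i) w)) *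
        (B (unitGrid N (i + 1)) w - B (unitGrid N i) w)
  have hM0 : 0 ≤ M := (abs_nonneg _).trans (hM 0 0)
  have hIle : ∀ w, |I w| ≤ M := fun w => by
    have h := intervalIntegral.norm_integral_le_of_norm_le_const (a := (0 : ℝ)) (b := 1)
      (f := fun s : ℝ => H s (B s.toNNReal w)) (C := M) fun s _ => hM s _
    simpa using h
  obtain ⟨hIi, hRi, hRI⟩ := hB.tendsto_integral_abs_sum_sub hH hM
  change Integrable I P at hIi
  change ∀ N, Integrable (R N) P at hRi
  change Filter.Tendsto (fun n : ℕ => ∫ w, |R (n + 1) w - I w| ∂P) Filter.atTop (nhds 0) at hRI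
  have hXR := fun n : ℕ => hB.integral_abs_discrete_covariation_sub_le hG
    (fun s => (hH.uncurry_left s).measurable) hK hM hGH (Nat.succ_pos n)
  have hXp := fun n : ℕ => hB.integral_pow_discrete_covariation_le (Nat.succ_pos n)
    (φ := fun i => G (unitGrid (n + 1) i)) (fun i => hG _) (fun i => hG1 _) k
  have hpow : Integrable (fun w => I w ^ (2 * k)) P :=
    (integrable_const (M ^ (2 * k))).mono' (hIi.1.pow _) (ae_of_all _ fun w => by
      rw [norm_pow]
      exact pow_le_pow_left₀ (norm_nonneg _) (hIle w) _)
  refine ⟨hpow, ?_⟩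
  set c : ℝ := 1 / 2 + 64 * M ^ 2 + 68 * K
  have hbound : ∀ n : ℕ, ∫ w, I w ^ (2 * k) ∂P ≤ 17 ^ (2 * k) * k.factorial +
      (2 * k : ℕ) * M ^ (2 * k - 1) *
        (c / √((n + 1 : ℕ) : ℝ) + ∫ w, |R (n + 1) w - I w| ∂P) := fun n => by
    obtain ⟨hDi, hD⟩ := hXR n
    obtain ⟨hXi, hX⟩ := hXp n
    change Integrable (fun w => X (n + 1) w - R (n + 1) w) P at hDi
    change ∫ w, |X (n + 1) w - R (n + 1) w| ∂P ≤ c / √((n + 1 : ℕ) : ℝ) at hD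
    change Integrable (fun w => X (n + 1) w ^ (2 * k)) P at hXi
    change ∫ w, X (n + 1) w ^ (2 * k) ∂P ≤ _ at hX
    have hRIi : Integrable (fun w => R (n + 1) w - I w) P := (hRi _).sub hIi
    have herr : Integrable (fun w => |X (n + 1) w - R (n + 1) w| + |R (n + 1) w - I w|) P :=
      hDi.abs.add hRIi.abs
    have hpt : ∀ w, I w ^ (2 * k) ≤ X (n + 1) w ^ (2 * k) + (2 * k : ℕ) * M ^ (2 * k - 1) *
        (|X (n + 1) w - R (n + 1) w| + |R (n + 1) w - I w|) := fun w => by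
      refine (pow_two_mul_le_add_of_pos hk (X (n + 1) w) (I w)).trans ?_
      rw [mul_assoc]
      have h : I w ^ (2 * k - 1) * (I w - X (n + 1) w) ≤
          M ^ (2 * k - 1) * (|X (n + 1) w - R (n + 1) w| + |R (n + 1) w - I w|) := by
        refine (le_abs_self _).trans ?_
        rw [abs_mul, abs_pow, abs_sub_comm (I w)]
        gcongr
        · exact hIle w
        · exact abs_sub_le _ _ _
      gcongr
    calc ∫ w, I w ^ (2 * k) ∂P ≤ ∫ w, (X (n + 1) w ^ (2 * k) + (2 * k : ℕ) * M ^ (2 * k - 1) *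
          (|X (n + 1) w - R (n + 1) w| + |R (n + 1) w - I w|)) ∂P :=
          integral_mono hpow (hXi.add (herr.const_mul _)) hpt
      _ = ∫ w, X (n + 1) w ^ (2 * k) ∂P + (2 * k : ℕ) * M ^ (2 * k - 1) *
          (∫ w, |X (n + 1) w - R (n + 1) w| ∂P + ∫ w, |R (n + 1) w - I w| ∂P) := by
          rw [integral_add hXi (herr.const_mul _), integral_const_mul,
            integral_add hDi.abs hRIi.abs]
      _ ≤ _ := by gcongr
  have hsqrt : Filter.Tendsto (fun n : ℕ => c / √((n + 1 : ℕ) : ℝ)) Filter.atTop (nhds 0) :=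
    (Real.tendsto_sqrt_atTop.comp
      (tendsto_natCast_atTop_atTop.comp (Filter.tendsto_add_atTop_nat 1))).const_div_atTop c
  have hlim := ((hsqrt.add hRI).const_mul ((2 * k : ℕ) * M ^ (2 * k - 1))).const_add
    ((17 : ℝ) ^ (2 * k) * k.factorial)
  simp only [add_zero, mul_zero] at hlim
  exact ge_of_tendsto' hlim hbound

end ProbabilityTheory.IsBrownianReal

/-! ### Functions smooth up to the boundary of the strip -/

/-- The closed strip `[0, 1] × ℝ`. -/
abbrev unitStrip : Set (ℝ × ℝ) := Icc (0 : ℝ) 1 ×ˢ univ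

/-- The derivative in the second variable of a function smooth on the closed strip is the derivative within
the strip in the direction `(0, 1)`, since vertical lines stay in the strip. -/
theorem hasDerivAt_snd_and_contDiffOn_deriv_snd {f : ℝ × ℝ → ℝ} (hf : ContDiffOn ℝ ∞ f unitStrip) :
    (∀ q ∈ unitStrip, HasDerivAt (fun z => f (q.1, z)) (deriv (fun z => f (q.1, z)) q.2) q.2) ∧
    ContDiffOn ℝ ∞ (fun q : ℝ × ℝ => deriv (fun z => f (q.1, z)) q.2) unitStrip := by
  have hS : UniqueDiffOn ℝ unitStrip := (uniqueDiffOn_Icc zero_lt_one).prod uniqueDiffOn_univ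
  have hd : ∀ q ∈ unitStrip, HasDerivAt (fun z => f (q.1, z))
      (fderivWithin ℝ f unitStrip q (0, 1)) q.2 := fun q hq => by
    have h1 : HasFDerivWithinAt f (fderivWithin ℝ f unitStrip q) unitStrip (q.1, q.2) :=
      ((hf.differentiableOn (by simp)) q hq).hasFDerivWithinAt
    have h2 : HasDerivWithinAt (fun z : ℝ => (q.1, z)) (0, 1) univ q.2 :=
      ((hasDerivAt_const q.2 q.1).prodMk (hasDerivAt_id q.2)).hasDerivWithinAt
    exact (h1.comp_hasDerivWithinAt q.2 h2 fun z _ => ⟨hq.1, mem_univ z⟩).hasDerivAt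
      Filter.univ_mem
  refine ⟨fun q hq => (hd q hq).differentiableAt.hasDerivAt, ?_⟩
  refine ContDiffOn.congr ?_ fun q hq => (hd q hq).deriv
  exact (hf.fderivWithin hS (by simp)).clm_apply contDiffOn_const

theorem exists_abs_le_of_eq_zero {f : ℝ × ℝ → ℝ} (hf : ContinuousOn f unitStrip) {R : ℝ}
    (hR : ∀ q ∈ unitStrip, R < |q.2| → f q = 0) : ∃ M, 0 ≤ M ∧ ∀ q ∈ unitStrip, |f q| ≤ M := by
  have hK : IsCompact (Icc (0 : ℝ) 1 ×ˢ Icc (-R) R) := isCompact_Icc.prod isCompact_Icc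
  obtain ⟨M, hM⟩ := hK.exists_bound_of_continuousOn
    (hf.mono (prod_mono le_rfl (subset_univ _)))
  refine ⟨max M 0, le_max_right _ _, fun q hq => ?_⟩
  rcases lt_or_ge R |q.2| with h | h
  · rw [hR q hq h, abs_zero]
    exact le_max_right _ _
  · exact (hM q ⟨hq.1, abs_le.1 h⟩).trans (le_max_left _ _)

theorem deriv_snd_eq_zero {f : ℝ × ℝ → ℝ} {R : ℝ} (hR : ∀ q ∈ unitStrip, R < |q.2| → f q = 0) :
    ∀ q ∈ unitStrip, R < |q.2| → deriv (fun z => f (q.1, z)) q.2 = 0 := fun q hq h => by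
  have : (fun z => f (q.1, z)) =ᶠ[nhds q.2] fun _ => 0 := by
    filter_upwards [(isOpen_lt continuous_const continuous_abs).mem_nhds h] with z hz
    exact hR (q.1, z) ⟨hq.1, mem_univ z⟩ hz
  rw [this.deriv_eq, deriv_const]

theorem exists_eq_zero_of_hasCompactSupport {f : ℝ × ℝ → ℝ}
    (hf : HasCompactSupport (unitStrip.domRestrict f)) :
    ∃ R, ∀ q ∈ unitStrip, R < |q.2| → f q = 0 := by
  obtain ⟨R, hR⟩ := hf.isCompact.exists_bound_of_continuousOn
    (f := fun q : unitStrip => q.1.2) (by fun_prop)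
  refine ⟨R, fun q hq h => ?_⟩
  by_contra hne
  exact absurd (hR ⟨q, hq⟩ (subset_tsupport _ hne)) (not_le.2 h)

/-- First-order Taylor formula with a global bound on the second derivative. -/
theorem abs_sub_sub_mul_le {f f' f'' : ℝ → ℝ} {K : ℝ} (hf : ∀ z, HasDerivAt f (f' z) z)
    (hf' : ∀ z, HasDerivAt f' (f'' z) z) (hK : ∀ z, |f'' z| ≤ K) (x y : ℝ) :
    |f y - f x - f' x * (y - x)| ≤ K * (y - x) ^ 2 := by
  have h1 : ∀ z, |f' z - f' x| ≤ K * |z - x| := fun z =>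
    convex_univ.norm_image_sub_le_of_norm_hasDerivWithin_le
      (fun u _ => (hf' u).hasDerivWithinAt) (fun u _ => hK u) (mem_univ x) (mem_univ z)
  have hK0 : 0 ≤ K := (abs_nonneg _).trans (hK 0)
  have h2 := (convex_uIcc x y).norm_image_sub_le_of_norm_hasDerivWithin_le
    (f := fun z => f z - f' x * z) (f' := fun z => f' z - f' x) (C := K * |y - x|)
    (fun u _ => ((hf u).sub (by simpa using (hasDerivAt_id u).const_mul (f' x))).hasDerivWithinAt)
    (fun u hu => (h1 u).trans 
      (mul_le_mul_of_nonneg_left (abs_sub_left_of_mem_uIcc hu) hK0)) left_mem_uIcc right_mem_uIcc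
  rw [Real.norm_eq_abs, Real.norm_eq_abs, mul_assoc, abs_mul_abs_self] at h2
  convert h2 using 2 <;> ring

theorem proposition2p2 :
    ∃ C : ℝ, 0 < C ∧
      ∀ {Ω : Type*} [MeasurableSpace Ω] (P : Measure Ω) [IsProbabilityMeasure P]
        (W : ℝ≥0 → Ω → ℝ) (_hW : IsBrownianReal W P)
        (g : ℝ × ℝ → ℝ)
        (_hg_smooth : ContDiffOn ℝ ∞ g (Icc (0 : ℝ) 1 ×ˢ (univ : Set ℝ)))
        (_hg_supp : HasCompactSupport ((Icc (0 : ℝ) 1 ×ˢ (univ : Set ℝ)).domRestrict g))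
        (_hg_bound : ∀ s ∈ Icc (0 : ℝ) 1, ∀ z : ℝ, |g (s, z)| ≤ 1)
        (p : ℕ) (_hp_even : Even p) (_hp_pos : 0 < p),
        (∀ᵐ w ∂P, IntervalIntegrable
          (fun t : ℝ => deriv (fun z : ℝ => g (t, z)) (W t.toNNReal w)) volume 0 1) ∧
        Integrable (fun w : Ω =>
          (∫ t in (0 : ℝ)..1, deriv (fun z : ℝ => g (t, z)) (W t.toNNReal w)) ^ p) P ∧
        (∫ w, (∫ t in (0 : ℝ)..1, deriv (fun z : ℝ => g (t, z)) (W t.toNNReal w)) ^ p ∂P)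
          ≤ C ^ p * (Nat.factorial (p / 2) : ℝ) := by
  refine ⟨17, by norm_num, ?_⟩
  intro Ω _ P _ W hW g hg hsupp hb p hpe hp
  obtain ⟨k, hk⟩ := hpe
  obtain rfl : p = 2 * k := by omega
  have hk0 : 0 < k := by omega
  obtain ⟨R, hR⟩ := exists_eq_zero_of_hasCompactSupport hsupp
  obtain ⟨hd1, hc1⟩ := hasDerivAt_snd_and_contDiffOn_deriv_snd hg
  obtain ⟨hd2, hc2⟩ := hasDerivAt_snd_and_contDiffOn_deriv_snd hc1
  have hR1 := deriv_snd_eq_zero hR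
  obtain ⟨M, -, hM⟩ := exists_abs_le_of_eq_zero hc1.continuousOn hR1
  obtain ⟨K, hK0, hK⟩ := exists_abs_le_of_eq_zero hc2.continuousOn (deriv_snd_eq_zero hR1)
  -- nothing is assumed of `g` at times outside `[0, 1]`: extend it by its values at the end points
  let r : ℝ → ℝ := fun s => projIcc (0 : ℝ) 1 zero_le_one s
  have hr : Continuous r := continuous_subtype_val.comp continuous_projIcc
  have hrS : ∀ s z, (r s, z) ∈ unitStrip := fun s z =>
    ⟨(projIcc (0 : ℝ) 1 zero_le_one s).2, mem_univ z⟩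
  have hrI : ∀ s ∈ Icc (0 : ℝ) 1, r s = s := fun s hs => by
    simp only [r, projIcc_of_mem zero_le_one hs]
  let G : ℝ → ℝ → ℝ := fun s z => g (r s, z)
  let H : ℝ → ℝ → ℝ := fun s z => deriv (fun y => g (r s, y)) z
  have hG : ∀ s, Measurable (G s) := fun s =>
    (hg.continuousOn.comp_continuous (by fun_prop) (hrS s)).measurable
  have hH : Continuous (Function.uncurry H) :=
    hc1.continuousOn.comp_continuous (f := fun q : ℝ × ℝ => (r q.1, q.2)) (by fun_prop)
      fun q => hrS _ _
  have hGH : ∀ s x y, |G s y - G s x - H s x * (y - x)| ≤ K * (y - x) ^ 2 := fun s =>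
    abs_sub_sub_mul_le (fun z => hd1 _ (hrS s z)) (fun z => hd2 _ (hrS s z))
      (fun z => hK _ (hrS s z))
  have hI : ∀ w, ∫ t in (0 : ℝ)..1, deriv (fun z : ℝ => g (t, z)) (W t.toNNReal w) =
      ∫ t in (0 : ℝ)..1, H t (W t.toNNReal w) := fun w =>
    intervalIntegral.integral_congr fun t ht => by
      rw [uIcc_of_le zero_le_one] at ht
      simp only [H, hrI t ht]
  simp_rw [hI]
  rw [Nat.mul_div_cancel_left k two_pos]
  refine ⟨?_, hW.integral_pow_path_integral_le hG (fun s x => hb _ (hrS s x).1 x) hH hK0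
    (fun s x => hM _ (hrS s x)) hGH hk0⟩
  filter_upwards [hW.ae_continuous_comp hH] with w hw
  refine (hw.intervalIntegrable 0 1).congr fun t ht => ?_
  rw [uIoc_of_le zero_le_one] at ht
  simp only [H, hrI t ⟨ht.1.le, ht.2⟩]
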